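/- Work in ZFC. A sequence $\vec U=\langle\kappa\rangle^\frown\langle U_\alpha\mid\alpha<\ell(\vec U)\rangle$, where $\kappa$ is a measurable cardinal and each $U_\alpha$ is a measure on $V_\kappa$ (a $\kappa$-complete, normal, nonprincipal ultrafilter on $V_\kappa$), is called a measure sequence on $\kappa$ if there is an elementary embedding $j:V\to M$ into a transitive class $M$ such that for every $\beta<\ell(\vec U)$ we have $\vec U\restriction\beta\in M$ and $U_\beta=\{X\subseteq V_\kappa\mid \vec U\restriction\beta\in j(X)\}$, where $\vec U\restriction\beta=\langle\kappa\rangle^\frown\langle U_\alpha\mid\alpha<\beta\rangle$. For a measure sequence $\bar\mu$ write $\kappa(\bar\mu)$ for its first entry, and let $\bigcap\bar\mu$ be the family of all $X\subseteq V_{\kappa(\bar\mu)}$ that belong to every measure of $\bar\mu$. Let $\vec U$ be a measure sequence on $\kappa$. Let $\mathcal{MS}$ be the set of all measure sequences $\bar\mu\in V_\kappa$ (on measurable cardinals $\kappa(\bar\mu)<\kappa$). A measure function is a function $b:\mathcal{MS}\to V_\kappa$ with $b(\bar\mu)\in\bigcap\bar\mu$ for every $\bar\mu\in\mathcal{MS}$.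 For a measure function $b$ and $\bar\mu\in\mathcal{MS}$ let $X_{b,\bar\mu}=\{\bar\nu\in\mathcal{MS}\mid\bar\mu\in b(\bar\nu)\}$, and for a family $W$ of sets let $[b]_W=\{\bar\mu\in\mathcal{MS}\mid X_{b,\bar\mu}\in W\}$. A repeat filter of $b$ with respect to $\vec U$ is a filter $W\subseteq\mathcal P(\mathcal{MS})$ such that (a) $W$ is $\kappa$-complete, and $\{\bar\mu\in\mathcal{MS}\mid\kappa(\bar\mu)>\alpha\}\in W$ for every $\alpha<\kappa$; (b) $W\subseteq\bigcup_{\alpha<\ell(\vec U)}U_\alpha$; (c) for every $\bar\mu\in\mathcal{MS}$, $X_{b,\bar\mu}\in W$ or $\mathcal{MS}\setminus X_{b,\bar\mu}\in W$; (d) $[b]_W\in\bigcap\vec U$. Such a $W$ is normal if it is closed under diagonal intersections: whenever $A_y\in W$ for all $y\in V_\kappa$, then $\{\bar\nu\in\mathcal{MS}\mid \bar\nu\in A_y\text{ for all }y\in V_{\kappa(\bar\nu)}\}\in W$. (Normality of measures on $V_\kappa$ is defined in the same way, with $V_\kappa$ in place of $\mathcal{MS}$, where elements of $V_\kappa$ without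 an ordinal first entry are treated as having first entry $0$.) The sequence $\vec U$ satisfies $\mathrm{WRP}^+$ if every measure function has a normal repeat filter with respect to $\vec U$. It satisfies the Local Repeat Property (LRP) if for every measure function $b$ there is a single $\tau<\ell(\vec U)$ with $[b]_{U_\tau}\in\bigcap\vec U$. Then, for every measure sequence $\vec U$, $\vec U$ satisfies $\mathrm{WRP}^+$ if and only if it satisfies LRP. -/

import Mathlib

open scoped ZFSet Cardinal FirstOrder

universe u

/-! The universe `V` of sets is `ZFSet`. First-order language of set theory. -/

/-- The only non-logical symbol of the language of set theory: a binary relation. -/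
inductive MemRel : ℕ → Type
  | mem : MemRel 2

/-- The first-order language of set theory. -/
abbrev setLanguage : FirstOrder.Language := ⟨fun _ => Empty, MemRel⟩

/-- The universe of sets with its true membership relation. -/
instance universeStructure : setLanguage.Structure ZFSet.{u} where
  funMap := fun f => f.elim
  RelMap := fun {_} r => match r with
    | .mem => fun v => v 0 ∈ v 1

/-- A class of sets with the true membership relation. -/
instance classStructure (M : Set ZFSet.{u}) : setLanguage.Structure M where
  funMap := fun f => f.elim
  RelMap := fun {_} r => match r with
    | .mem => fun v => (v 0 : ZFSet) ∈ (v 1 : ZFSet)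

/-- A transitive class of sets. -/
def IsTransitiveClass (M : Set ZFSet.{u}) : Prop :=
  ∀ x ∈ M, ∀ y ∈ x, y ∈ M

/-- `κ` is a measurable cardinal: uncountable, and carrying a `κ`-complete nonprincipal
ultrafilter. -/
def IsMeasurableCardinal (κ : Cardinal.{u}) : Prop :=
  ℵ₀ < κ ∧ ∃ F : Ultrafilter κ.out,
    CardinalInterFilter (F : Filter κ.out) κ ∧ ∀ a : κ.out, ({a} : Set κ.out) ∉ F

/-- `F` is a (proper) filter on the set `D`. -/
structure IsFilterOn (D F : ZFSet.{u}) : Prop where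
  subset : ∀ X ∈ F, X ⊆ D
  univ_mem : D ∈ F
  empty_notMem : ∅ ∉ F
  mem_of_superset : ∀ X ∈ F, ∀ Y, X ⊆ Y → Y ⊆ D → Y ∈ F
  inter_mem : ∀ X ∈ F, ∀ Y ∈ F, X ∩ Y ∈ F

/-- `F` is closed under intersections (in `D`) of fewer than `κ` of its members. -/
def IsCompleteOn (κ : Cardinal.{u}) (D F : ZFSet.{u}) : Prop :=
  ∀ I : Type u, #I < κ → ∀ A : I → ZFSet.{u}, (∀ i, A i ∈ F) →
    ZFSet.sep (fun x => ∀ i, x ∈ A i) D ∈ F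

/-- The diagonal intersection of a family of sets indexed by sets,
`{x ∈ D | x ∈ A y for all y ∈ V_ν, where ν is the first entry of x}`.
(An `x` that has no ordinal as first entry is treated as having first entry `0`.) -/
noncomputable def diagInter (D : ZFSet.{u}) (A : ZFSet.{u} → ZFSet.{u}) : ZFSet.{u} :=
  ZFSet.sep (fun x => ∀ (ν : Ordinal.{u}) (f : ZFSet.{u}), x = ZFSet.pair ν.toZFSet f →
    ∀ y ∈ V_ ν, x ∈ A y) D

/-- `F` is normal: the diagonal intersection of every family of members of `F`
indexed by `V_κ` belongs to `F`. -/
def IsNormalOn (κ : Cardinal.{u}) (D F : ZFSet.{u}) : Prop :=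
  ∀ A : ZFSet.{u} → ZFSet.{u}, (∀ y ∈ V_ κ.ord, A y ∈ F) → diagInter D A ∈ F

/-- A measure on `V_κ`: a `κ`-complete normal nonprincipal ultrafilter on the set `V_κ`. -/
structure IsMeasureOn (κ : Cardinal.{u}) (F : ZFSet.{u}) : Prop where
  isFilter : IsFilterOn (V_ κ.ord) F
  ultra : ∀ X ⊆ V_ κ.ord, X ∈ F ∨ V_ κ.ord \ X ∈ F
  nonprincipal : ∀ x : ZFSet.{u}, ({x} : ZFSet.{u}) ∉ F
  complete : IsCompleteOn κ (V_ κ.ord) F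
  normal : IsNormalOn κ (V_ κ.ord) F

/-- The data of a sequence `⟨κ⟩ ⌢ ⟨U α | α < len⟩`; the values `U α` for `α ≥ len`
are irrelevant. -/
structure MSeq where
  κ : Cardinal.{u}
  len : Ordinal.{u}
  U : Ordinal.{u} → ZFSet.{u}

namespace MSeq

/-- The initial segment `⟨κ⟩ ⌢ ⟨U α | α < β⟩` (used for `β < len`). -/
def restrict (S : MSeq.{u}) (β : Ordinal.{u}) : MSeq.{u} := ⟨S.κ, β, S.U⟩

/-- The sequence as a set: the pair of `κ` and the function `α ↦ U α` with domain `len`. -/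
noncomputable def code (S : MSeq.{u}) : ZFSet.{u} :=
  ZFSet.pair S.κ.ord.toZFSet
    (ZFSet.range fun α : Set.Iio S.len => ZFSet.pair (α : Ordinal.{u}).toZFSet (S.U α))

/-- The filter `⋂ U` on `V_κ`: the sets `X ⊆ V_κ` that belong to every `U α`, `α < len`. -/
noncomputable def cap (S : MSeq.{u}) : ZFSet.{u} :=
  ZFSet.sep (fun X => ∀ α < S.len, X ∈ S.U α) (ZFSet.powerset (V_ S.κ.ord))

/-- `S` is a measure sequence: `κ` is measurable, each `U α` is a measure on `V_κ`, and there is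
an elementary embedding `j : V → M` into a transitive class such that for every `β < len`,
`U ↾ β ∈ M` and `U β = {X ⊆ V_κ | U ↾ β ∈ j X}`. -/
structure IsMeasureSequence (S : MSeq.{u}) : Prop where
  measurable : IsMeasurableCardinal S.κ
  measure : ∀ α < S.len, IsMeasureOn S.κ (S.U α)
  embedding : ∃ M : Set ZFSet.{u}, IsTransitiveClass M ∧
    ∃ j : ZFSet.{u} ↪ₑ[setLanguage] M, ∀ β < S.len,
      (S.restrict β).code ∈ M ∧
      ∀ X : ZFSet.{u}, X ∈ S.U β ↔ X ⊆ V_ S.κ.ord ∧ (S.restrict β).code ∈ (j X : ZFSet.{u})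

end MSeq

/-- The set of all measure sequences in `V_κ` on measurable cardinals below `κ`. -/
noncomputable def MS (κ : Cardinal.{u}) : ZFSet.{u} :=
  ZFSet.sep (fun x => ∃ S : MSeq.{u}, S.IsMeasureSequence ∧ S.κ < κ ∧ S.code = x) (V_ κ.ord)

/-- `b` is a measure function for `κ`: `b μ ∈ ⋂ μ` for every `μ ∈ MS`. Only the values of `b`
on `MS κ` matter; they are automatically in `V_κ`, as `⋂ μ` consists of subsets of `V_κ(μ)`. -/
def IsMeasureFunction (κ : Cardinal.{u}) (b : ZFSet.{u} → ZFSet.{u}) : Prop :=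
  ∀ S : MSeq.{u}, S.IsMeasureSequence → S.code ∈ MS κ → b S.code ∈ S.cap

/-- `X_{b,μ} = {ν ∈ MS | μ ∈ b ν}`. -/
noncomputable def XSet (κ : Cardinal.{u}) (b : ZFSet.{u} → ZFSet.{u}) (μ : ZFSet.{u}) :
    ZFSet.{u} :=
  ZFSet.sep (fun ν => μ ∈ b ν) (MS κ)

/-- `W` measures `b`: for every `μ ∈ MS`, `X_{b,μ} ∈ W` or `MS \ X_{b,μ} ∈ W`. -/
def Measures (κ : Cardinal.{u}) (W : ZFSet.{u}) (b : ZFSet.{u} → ZFSet.{u}) : Prop :=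
  ∀ μ ∈ MS κ, XSet κ b μ ∈ W ∨ MS κ \ XSet κ b μ ∈ W

/-- `[b]_W = {μ ∈ MS | X_{b,μ} ∈ W}`. -/
noncomputable def bracket (κ : Cardinal.{u}) (b : ZFSet.{u} → ZFSet.{u}) (W : ZFSet.{u}) :
    ZFSet.{u} :=
  ZFSet.sep (fun μ => XSet κ b μ ∈ W) (MS κ)

namespace MSeq

/-- `W` is a repeat filter of `b` with respect to `S`. -/
structure IsRepeatFilter (S : MSeq.{u}) (b : ZFSet.{u} → ZFSet.{u}) (W : ZFSet.{u}) : Prop where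
  isFilter : IsFilterOn (MS S.κ) W
  complete : IsCompleteOn S.κ (MS S.κ) W
  /-- `{μ ∈ MS | κ(μ) > α} ∈ W` for all `α < κ`. -/
  cobounded : ∀ α < S.κ.ord,
    ZFSet.sep (fun x => ∃ (ν : Ordinal.{u}) (f : ZFSet.{u}),
      x = ZFSet.pair ν.toZFSet f ∧ α < ν) (MS S.κ) ∈ W
  subset_union : ∀ X ∈ W, ∃ α < S.len, X ∈ S.U α
  measures : Measures S.κ W b
  bracket_mem : bracket S.κ b W ∈ S.cap

/-- `WRP⁺`: every measure function has a normal repeat filter with respect to `S`. -/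
def WRPPlus (S : MSeq.{u}) : Prop :=
  ∀ b : ZFSet.{u} → ZFSet.{u}, IsMeasureFunction S.κ b →
    ∃ W : ZFSet.{u}, S.IsRepeatFilter b W ∧ IsNormalOn S.κ (MS S.κ) W

/-- The Local Repeat Property: for every measure function `b` there is `τ < len` with
`[b]_{U τ} ∈ ⋂ U`. -/
def LRP (S : MSeq.{u}) : Prop :=
  ∀ b : ZFSet.{u} → ZFSet.{u}, IsMeasureFunction S.κ b →
    ∃ τ < S.len, bracket S.κ b (S.U τ) ∈ S.cap

end MSeq

/-!
Both directions rest on one fact, `MSeq.IsMeasureSequence.sep_lt_first_mem`: if `MS κ` belongs to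
a measure `U τ` of the sequence, then so does `{μ ∈ MS | κ(μ) > α}` for every `α < κ`. This is
not a matter of normality: as diagonal intersections are taken over first entries, a normal measure
on `V_κ` may well concentrate on pairs with first entry `0`. It is obtained from the embedding `j`
instead. First, `j α < κ` for `α < κ`:
otherwise `⟨κ⟩ ∈ j {⟨ν⟩ | ν ≤ α}`, so `U 0` would contain a set with fewer than `κ` elements,
against completeness and nonprincipality. As `j α < κ` and `κ` is the first entry of every
`U ↾ τ`, the set `U ↾ τ` belongs to `j {μ ∈ MS | κ(μ) > α}`. Elementarity is used for three
explicit formulas; pairs and ordinals are absolute between `V` and a transitive class.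

From LRP to WRP⁺: if `[b]_{U τ} ∈ ⋂ U`, then this set is nonempty, hence `MS ∈ U τ`, and the
trace of `U τ` on `MS` is a normal repeat filter of `b`.

From WRP⁺ to LRP: let `W` be a normal repeat filter of `b`. The diagonal intersection of the sets
`X_{b,μ}` that belong to `W` is in `W`, hence in some `U τ`. Every `X_{b,μ} ∈ W` contains it up to
a set of sequences with bounded first entry, so `X_{b,μ} ∈ U τ`. Thus `[b]_W ⊆ [b]_{U τ}`, and
`[b]_{U τ} ∈ ⋂ U`.
-/

/-! ### Formulas of set theory -/

section Formulas

open FirstOrder Language BoundedFormula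

/-- The formula `xᵢ ∈ xⱼ`. -/
def memFormula {k : ℕ} (i j : Fin k) : setLanguage.BoundedFormula Empty k :=
  Relations.boundedFormula₂ (L := setLanguage) MemRel.mem
    (Term.var (Sum.inr i)) (Term.var (Sum.inr j))

/-- The formula `xᵢ = xⱼ`. -/
def eqFormula {k : ℕ} (i j : Fin k) : setLanguage.BoundedFormula Empty k :=
  Term.bdEqual (Term.var (Sum.inr i)) (Term.var (Sum.inr j))

/-- The formula saying that `x` is the Kuratowski pair of `n` and `e`: the elements of `x` are
exactly the sets `z` with `z = {n}` or `z = {n, e}`. -/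
def pairFormula {k : ℕ} (x n e : Fin k) : setLanguage.BoundedFormula Empty k :=
  ∀' ((memFormula (Fin.last k) x.castSucc) ⇔
    ((∀' (memFormula (Fin.last (k + 1)) (Fin.last k).castSucc ⇔
        eqFormula (Fin.last (k + 1)) n.castSucc.castSucc)) ⊔
     (∀' (memFormula (Fin.last (k + 1)) (Fin.last k).castSucc ⇔
        (eqFormula (Fin.last (k + 1)) n.castSucc.castSucc ⊔
         eqFormula (Fin.last (k + 1)) e.castSucc.castSucc)))))

/-- The formula saying that `x₀` is a transitive set on which membership is transitive. -/
def ordinalFormula : setLanguage.BoundedFormula Empty 1 :=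
  (∀' ∀' (memFormula 1 0 ⟹ memFormula 2 1 ⟹ memFormula 2 0)) ⊓
  (∀' ∀' ∀' (memFormula 1 2 ⟹ memFormula 2 3 ⟹ memFormula 3 0 ⟹ memFormula 1 3))

/-- The formula saying that `x₀` contains every pair `(n, ∅)` with `n ∈ x₁` or `n = x₁`. -/
def initialPairsFormula : setLanguage.BoundedFormula Empty 2 :=
  ∀' ∀' ∀' (pairFormula 2 3 4 ⟹ (memFormula 3 1 ⊔ eqFormula 3 1) ⟹
    (∀' ∼(memFormula 5 4)) ⟹ memFormula 2 0)

/-- The formula saying that `x₁` contains every pair `(n, e) ∈ x₀` with `x₂ ∈ n`. -/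
def firstEntryFormula : setLanguage.BoundedFormula Empty 3 :=
  ∀' ∀' ∀' (memFormula 3 0 ⟹ pairFormula 3 4 5 ⟹ memFormula 2 4 ⟹ memFormula 3 1)

@[simp]
theorem realize_memFormula_univ {k : ℕ} (i j : Fin k) (v : Empty → ZFSet.{u})
    (xs : Fin k → ZFSet.{u}) : (memFormula i j).Realize v xs ↔ xs i ∈ xs j := by
  rw [memFormula, realize_rel₂]; rfl

@[simp]
theorem realize_memFormula_class {M : Set ZFSet.{u}} {k : ℕ} (i j : Fin k) (v : Empty → M)
    (xs : Fin k → M) : (memFormula i j).Realize v xs ↔ (xs i : ZFSet) ∈ (xs j : ZFSet) := by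
  rw [memFormula, realize_rel₂]; rfl

@[simp]
theorem realize_eqFormula {N : Type*} [setLanguage.Structure N] {k : ℕ} (i j : Fin k)
    (v : Empty → N) (xs : Fin k → N) : (eqFormula i j).Realize v xs ↔ xs i = xs j :=
  Iff.rfl

/-- `pairFormula` is used for pairs in a hypothesis about `V`, transferred to a class `M`. So only
this implication is needed in `V`, and only the converse in `M`. -/
theorem eq_pair_of_realize_pairFormula {k : ℕ} {x n e : Fin k} {v : Empty → ZFSet.{u}}
    {xs : Fin k → ZFSet.{u}} (h : (pairFormula x n e).Realize v xs) :
    xs x = ZFSet.pair (xs n) (xs e) := by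
  simp only [pairFormula, realize_all, realize_iff, realize_memFormula_univ, Fin.snoc_last,
    Fin.snoc_castSucc, realize_sup, realize_eqFormula] at h
  ext z
  rw [h z, ZFSet.pair, ZFSet.mem_pair, ZFSet.ext_iff, ZFSet.ext_iff]
  simp

theorem realize_pairFormula_of_eq_pair {M : Set ZFSet.{u}} (hM : IsTransitiveClass M) {k : ℕ}
    {x n e : Fin k} {v : Empty → M} {xs : Fin k → M}
    (h : (xs x : ZFSet) = ZFSet.pair (xs n) (xs e)) : (pairFormula x n e).Realize v xs := by
  simp only [pairFormula, realize_all, realize_iff, realize_memFormula_class, Fin.snoc_last,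
    Fin.snoc_castSucc, realize_sup, realize_eqFormula, Subtype.forall, Subtype.ext_iff]
  intro z hz
  rw [h, ZFSet.pair, ZFSet.mem_pair]
  refine or_congr ⟨?_, fun H => ?_⟩ ⟨?_, fun H => ?_⟩
  · rintro rfl; simp
  · ext w
    rw [ZFSet.mem_singleton]
    exact ⟨fun hw => (H w (hM z hz w hw)).1 hw, fun hw => (H w (hw ▸ (xs n).2)).2 hw⟩
  · rintro rfl; simp
  · ext w
    rw [ZFSet.mem_pair]
    refine ⟨fun hw => (H w (hM z hz w hw)).1 hw, fun hw => (H w ?_).2 hw⟩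
    rcases hw with hw | hw
    · exact hw ▸ (xs n).2
    · exact hw ▸ (xs e).2

end Formulas

/-! ### Elementary embeddings into transitive classes -/

section Embedding

open FirstOrder Language

variable {M : Set ZFSet.{u}}

theorem IsTransitiveClass.fst_mem (hM : IsTransitiveClass M) {n e : ZFSet.{u}}
    (h : ZFSet.pair n e ∈ M) : n ∈ M :=
  hM {n} (hM _ h _ (by simp [ZFSet.pair])) _ (by simp)

theorem IsTransitiveClass.snd_mem (hM : IsTransitiveClass M) {n e : ZFSet.{u}}
    (h : ZFSet.pair n e ∈ M) : e ∈ M :=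
  hM {n, e} (hM _ h _ (by simp [ZFSet.pair])) _ (by simp)

theorem isOrdinal_map (hM : IsTransitiveClass M) (j : ZFSet.{u} ↪ₑ[setLanguage] M)
    {a : ZFSet.{u}} (ha : a.IsOrdinal) : (j a : ZFSet).IsOrdinal := by
  have h : ordinalFormula.Realize default ![a] := by
    simp only [ordinalFormula, BoundedFormula.realize_inf,
      BoundedFormula.realize_all,
      BoundedFormula.realize_imp, realize_memFormula_univ]
    exact ⟨fun y z hy hz => ha.mem_trans hz hy, fun y z w => ha.mem_trans'⟩
  rw [← j.map_boundedFormula] at h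
  simp only [ordinalFormula, BoundedFormula.realize_inf,
      BoundedFormula.realize_all,
      BoundedFormula.realize_imp, realize_memFormula_class] at h
  refine ⟨fun y hy z hz => ?_, fun {y z w} hyz hzw hw => ?_⟩
  · have hyM := hM _ (j a).2 y hy
    exact h.1 ⟨y, hyM⟩ ⟨z, hM _ hyM z hz⟩ hy hz
  · have hwM := hM _ (j a).2 w hw
    have hzM := hM _ hwM z hzw
    exact h.2 ⟨y, hM _ hzM y hyz⟩ ⟨z, hzM⟩ ⟨w, hwM⟩ hyz hzw hw

/-- Half of `j ((a ∪ {a}) × {∅}) = (j a ∪ {j a}) × {∅}`. -/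
theorem pair_empty_mem_map_prod (hM : IsTransitiveClass M) (j : ZFSet.{u} ↪ₑ[setLanguage] M)
    {a n : ZFSet.{u}} (hp : ZFSet.pair n ∅ ∈ M) (hn : n ∈ (j a : ZFSet) ∨ n = j a) :
    ZFSet.pair n ∅ ∈ (j (ZFSet.prod (insert a a) {∅}) : ZFSet) := by
  have h : initialPairsFormula.Realize default ![ZFSet.prod (insert a a) {∅}, a] := by
    simp only [initialPairsFormula, BoundedFormula.realize_all,
      BoundedFormula.realize_imp]
    intro x n e hx hn he
    have hx := eq_pair_of_realize_pairFormula hx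
    simp only [BoundedFormula.realize_sup,
      BoundedFormula.realize_not, realize_memFormula_univ,
      realize_eqFormula] at hn he ⊢
    change x = ZFSet.pair n e at hx
    change n ∈ a ∨ n = a at hn
    change ∀ z, z ∉ e at he
    change x ∈ ZFSet.prod (insert a a) {∅}
    rw [hx, ZFSet.pair_mem_prod, ZFSet.mem_insert_iff, ZFSet.mem_singleton,
      ZFSet.eq_empty]
    exact ⟨hn.symm, he⟩
  rw [← j.map_boundedFormula] at h
  simp only [initialPairsFormula, BoundedFormula.realize_all,
    BoundedFormula.realize_imp,
    BoundedFormula.realize_sup,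
    BoundedFormula.realize_not, realize_memFormula_class,
    realize_eqFormula] at h
  exact h ⟨_, hp⟩ ⟨n, hM.fst_mem hp⟩ ⟨∅, hM.snd_mem hp⟩ (realize_pairFormula_of_eq_pair hM rfl)
    (hn.imp id fun h => Subtype.ext h) fun z => ZFSet.notMem_empty _

/-- If `A` contains every pair in `D` whose first entry has `a` as an element, then `j A` contains
every pair in `j D` whose first entry has `j a` as an element. -/
theorem pair_mem_map (hM : IsTransitiveClass M) (j : ZFSet.{u} ↪ₑ[setLanguage] M)
    {D A a n e : ZFSet.{u}} (h : ∀ n e, ZFSet.pair n e ∈ D → a ∈ n → ZFSet.pair n e ∈ A)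
    (hp : ZFSet.pair n e ∈ (j D : ZFSet)) (hn : (j a : ZFSet) ∈ n) :
    ZFSet.pair n e ∈ (j A : ZFSet) := by
  have h : firstEntryFormula.Realize default ![D, A, a] := by
    simp only [firstEntryFormula, BoundedFormula.realize_all,
      BoundedFormula.realize_imp]
    intro x n e hD hx hn
    have hx := eq_pair_of_realize_pairFormula hx
    simp only [realize_memFormula_univ] at hD hn ⊢
    change x = ZFSet.pair n e at hx
    subst hx
    exact h n e hD hn
  rw [← j.map_boundedFormula] at h
  simp only [firstEntryFormula, BoundedFormula.realize_all,
    BoundedFormula.realize_imp, realize_memFormula_class] at h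
  have hpM := hM _ (j D).2 _ hp
  exact h ⟨_, hpM⟩ ⟨n, hM.fst_mem hpM⟩ ⟨e, hM.snd_mem hpM⟩ hp
    (realize_pairFormula_of_eq_pair hM rfl) hn

end Embedding

/-! ### Measure sequences -/

theorem exists_eq_pair_of_mem_MS {κ : Cardinal.{u}} {x : ZFSet.{u}} (hx : x ∈ MS κ) :
    ∃ (ν : Ordinal.{u}) (f : ZFSet.{u}), x = ZFSet.pair ν.toZFSet f := by
  obtain ⟨-, S, -, -, rfl⟩ := ZFSet.mem_sep.1 hx
  exact ⟨_, _, rfl⟩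

theorem MS_subset (κ : Cardinal.{u}) : MS κ ⊆ V_ κ.ord := fun _ hx => (ZFSet.mem_sep.1 hx).1

theorem XSet_subset (κ : Cardinal.{u}) (b : ZFSet.{u} → ZFSet.{u}) (μ : ZFSet.{u}) :
    XSet κ b μ ⊆ MS κ := fun _ hx => (ZFSet.mem_sep.1 hx).1

theorem diagInter_subset (D : ZFSet.{u}) (A : ZFSet.{u} → ZFSet.{u}) : diagInter D A ⊆ D :=
  fun _ hx => (ZFSet.mem_sep.1 hx).1

theorem MSeq.code_restrict_zero (S : MSeq.{u}) :
    (S.restrict 0).code = ZFSet.pair S.κ.ord.toZFSet ∅ := by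
  have : ZFSet.range (fun α : Set.Iio (S.restrict 0).len =>
      ZFSet.pair (α : Ordinal.{u}).toZFSet ((S.restrict 0).U α)) = ∅ := by
    rw [ZFSet.eq_empty]
    intro y hy
    obtain ⟨⟨α, hα⟩, -⟩ := ZFSet.mem_range.1 hy
    exact not_lt_bot (a := α) hα
  rw [MSeq.code, this]
  rfl

/-- A member of a measure on `V_κ` has at least `κ` elements. -/
theorem IsMeasureOn.le_card {κ : Cardinal.{u}} {F C : ZFSet.{u}} (hF : IsMeasureOn κ F)
    (hC : C ∈ F) : κ ≤ C.card := by
  by_contra! hlt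
  have hsub := hF.isFilter.subset C hC
  have key := hF.complete (Shrink.{u} C) hlt
    (fun i => V_ κ.ord \ {((equivShrink C).symm i : ZFSet)}) fun i =>
      (hF.ultra _ (fun x hx => by
        rw [ZFSet.mem_singleton.1 hx]
        exact hsub ((equivShrink C).symm i).2)).resolve_left (hF.nonprincipal _)
  refine hF.isFilter.empty_notMem ?_
  convert hF.isFilter.inter_mem _ hC _ key
  symm
  rw [ZFSet.eq_empty]
  intro x hx
  obtain ⟨hxC, hx⟩ := ZFSet.mem_inter.1 hx
  have := (ZFSet.mem_sep.1 hx).2 (equivShrink C ⟨x, hxC⟩)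
  simp at this

namespace MSeq

variable {S : MSeq.{u}}

/-- An embedding that generates a nonempty measure sequence on `κ` maps the ordinals below `κ`
to ordinals below `κ`. -/
theorem IsMeasureSequence.map_toZFSet_mem (hS : S.IsMeasureSequence) (h0 : 0 < S.len)
    {M : Set ZFSet.{u}} (hM : IsTransitiveClass M) (j : ZFSet.{u} ↪ₑ[setLanguage] M)
    (hj : (S.restrict 0).code ∈ M ∧ ∀ X : ZFSet.{u},
      X ∈ S.U 0 ↔ X ⊆ V_ S.κ.ord ∧ (S.restrict 0).code ∈ (j X : ZFSet))
    {α : Ordinal.{u}} (hα : α < S.κ.ord) :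
    (j α.toZFSet : ZFSet) ∈ S.κ.ord.toZFSet := by
  by_contra hcon
  rw [code_restrict_zero] at hj
  have hlim := Cardinal.isSuccLimit_ord hS.measurable.1.le
  have hκ : S.κ.ord.toZFSet ∈ (j α.toZFSet : ZFSet) ∨ S.κ.ord.toZFSet = j α.toZFSet := by
    rcases (ZFSet.isOrdinal_toZFSet S.κ.ord).mem_trichotomous
      (isOrdinal_map hM j (ZFSet.isOrdinal_toZFSet α)) with h | h | h
    exacts [.inl h, .inr h, (hcon h).elim]
  have hC := pair_empty_mem_map_prod hM j hj.1 hκ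
  rw [← Ordinal.toZFSet_add_one] at hC
  have hsub : ZFSet.prod (α + 1).toZFSet {∅} ⊆ V_ S.κ.ord := by
    intro x hx
    obtain ⟨n, hn, e, he, rfl⟩ := ZFSet.mem_prod.1 hx
    obtain ⟨ν, hν, rfl⟩ := Ordinal.mem_toZFSet_iff.1 hn
    have hν : ν < S.κ.ord := hν.trans (hlim.succ_lt hα)
    rw [ZFSet.mem_singleton.1 he, ZFSet.mem_vonNeumann, ZFSet.pair]
    simp only [ZFSet.rank_pair, ZFSet.rank_singleton, Ordinal.rank_toZFSet, ZFSet.rank_empty,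
      max_lt_iff]
    have h0 : (0 : Ordinal) < S.κ.ord := zero_le.trans_lt hν
    exact ⟨hlim.succ_lt (hlim.succ_lt hν),
      hlim.succ_lt (max_lt (hlim.succ_lt hν) (hlim.succ_lt h0))⟩
  have hle := (hS.measure 0 h0).le_card ((hj.2 _).2 ⟨hsub, hC⟩)
  have himage : ZFSet.prod (α + 1).toZFSet {∅} ⊆
      ZFSet.range fun i : Shrink.{u} (α + 1).toZFSet =>
        ZFSet.pair ((equivShrink (α + 1).toZFSet).symm i : ZFSet) ∅ := by
    intro x hx
    obtain ⟨n, hn, e, he, rfl⟩ := ZFSet.mem_prod.1 hx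
    rw [ZFSet.mem_singleton.1 he]
    exact ZFSet.mem_range.2 ⟨equivShrink _ ⟨n, hn⟩, by simp⟩
  -- Completeness forbids this, as `{⟨ν⟩ | ν ≤ α}` has fewer than `κ` elements.
  have hcard : (ZFSet.prod (α + 1).toZFSet {∅}).card ≤ (α + 1).card := by
    refine (ZFSet.card_mono himage).trans ?_
    rw [← Ordinal.card_toZFSet]
    have := ZFSet.lift_card_range_le (f := fun i : Shrink.{u} (α + 1).toZFSet =>
      ZFSet.pair ((equivShrink (α + 1).toZFSet).symm i : ZFSet) ∅)
    rwa [Cardinal.lift_id, Cardinal.lift_id] at this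
  exact (hle.trans hcard).not_gt (Cardinal.lt_ord.1 (hlim.succ_lt hα))

/-- The measures of a measure sequence on `κ` that concentrate on `MS κ` concentrate on sequences
with arbitrarily large first entry below `κ`. -/
theorem IsMeasureSequence.sep_lt_first_mem (hS : S.IsMeasureSequence) {τ : Ordinal.{u}}
    (hτ : τ < S.len) (hMS : MS S.κ ∈ S.U τ) {α : Ordinal.{u}} (hα : α < S.κ.ord) :
    ZFSet.sep (fun x => ∃ (ν : Ordinal.{u}) (f : ZFSet.{u}),
      x = ZFSet.pair ν.toZFSet f ∧ α < ν) (MS S.κ) ∈ S.U τ := by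
  obtain ⟨M, hM, j, hj⟩ := hS.embedding
  have h0 : 0 < S.len := zero_le.trans_lt hτ
  have hjα := hS.map_toZFSet_mem h0 hM j (hj 0 h0) hα
  refine ((hj τ hτ).2 _).2 ⟨fun x hx => MS_subset _ (ZFSet.mem_sep.1 hx).1, ?_⟩
  refine pair_mem_map hM j (fun n e hD hn => ?_) (((hj τ hτ).2 _).1 hMS).2 hjα
  obtain ⟨ν, f, hνf⟩ := exists_eq_pair_of_mem_MS hD
  refine ZFSet.mem_sep.2 ⟨hD, ν, f, hνf, ?_⟩
  rw [(ZFSet.pair_inj.1 hνf).1] at hn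
  exact Ordinal.toZFSet_mem_toZFSet_iff.1 hn

/-- If `b` has a normal repeat filter `W`, then `[b]_{U τ} ∈ ⋂ U` for any `U τ` that contains the
diagonal intersection of the sets `X_{b,μ} ∈ W`, since then `[b]_W ⊆ [b]_{U τ}`. -/
theorem IsMeasureSequence.exists_bracket_mem_cap (hS : S.IsMeasureSequence)
    {b : ZFSet.{u} → ZFSet.{u}} {W : ZFSet.{u}} (hW : S.IsRepeatFilter b W)
    (hn : IsNormalOn S.κ (MS S.κ) W) : ∃ τ < S.len, bracket S.κ b (S.U τ) ∈ S.cap := by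
  classical
  let A : ZFSet.{u} → ZFSet.{u} := fun y => if XSet S.κ b y ∈ W then XSet S.κ b y else MS S.κ
  have hA : diagInter (MS S.κ) A ∈ W := hn A fun y _ => by
    by_cases h : XSet S.κ b y ∈ W
    · simpa only [A, if_pos h] using h
    · simpa only [A, if_neg h] using hW.isFilter.univ_mem
  obtain ⟨τ, hτ, hY⟩ := hW.subset_union _ hA
  have hF := (hS.measure τ hτ).isFilter
  have hMS : MS S.κ ∈ S.U τ :=
    hF.mem_of_superset _ hY _ (diagInter_subset _ _) (MS_subset _)
  have hsub : bracket S.κ b W ⊆ bracket S.κ b (S.U τ) := by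
    intro μ hμ
    obtain ⟨hμ, hX⟩ := ZFSet.mem_sep.1 hμ
    refine ZFSet.mem_sep.2 ⟨hμ, ?_⟩
    -- On sequences with first entry above `rank μ`, the index `μ` is in the range of the diagonal
    -- intersection.
    have hrank := ZFSet.mem_vonNeumann.1 (MS_subset _ hμ)
    refine hF.mem_of_superset _ (hF.inter_mem _ hY _ (hS.sep_lt_first_mem hτ hMS hrank)) _ ?_
      fun x hx => MS_subset _ (XSet_subset _ _ _ hx)
    intro x hx
    obtain ⟨hxY, hx⟩ := ZFSet.mem_inter.1 hx
    obtain ⟨-, ν, f, hνf, hν⟩ := ZFSet.mem_sep.1 hx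
    have := (ZFSet.mem_sep.1 hxY).2 ν f hνf μ (ZFSet.mem_vonNeumann.2 hν)
    simpa only [A, if_pos hX] using this
  refine ⟨τ, hτ, ?_⟩
  have hcap := ZFSet.mem_sep.1 hW.bracket_mem
  have hV : bracket S.κ b (S.U τ) ⊆ V_ S.κ.ord :=
    fun x hx => MS_subset _ (ZFSet.mem_sep.1 hx).1
  exact ZFSet.mem_sep.2 ⟨ZFSet.mem_powerset.2 hV, fun α hα =>
    (hS.measure α hα).isFilter.mem_of_superset _ (hcap.2 α hα) _ hsub hV⟩

/-- The trace on `MS` of a measure `U τ` with `[b]_{U τ} ∈ ⋂ U` is a normal repeat filter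
of `b`. -/
theorem IsMeasureSequence.exists_isRepeatFilter (hS : S.IsMeasureSequence)
    {b : ZFSet.{u} → ZFSet.{u}} {τ : Ordinal.{u}} (hτ : τ < S.len)
    (hb : bracket S.κ b (S.U τ) ∈ S.cap) :
    ∃ W : ZFSet.{u}, S.IsRepeatFilter b W ∧ IsNormalOn S.κ (MS S.κ) W := by
  have hF := (hS.measure τ hτ).isFilter
  have hbτ := (ZFSet.mem_sep.1 hb).2 τ hτ
  have hMS : MS S.κ ∈ S.U τ := by
    -- `[b]_{U τ}` belongs to `U τ`, so it is nonempty, and some `X_{b,μ} ⊆ MS` is in `U τ`.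
    obtain ⟨μ, hμ⟩ : ∃ μ, μ ∈ bracket S.κ b (S.U τ) := by
      by_contra! h
      exact hF.empty_notMem ((ZFSet.eq_empty _).2 h ▸ hbτ)
    exact hF.mem_of_superset _ (ZFSet.mem_sep.1 hμ).2 _ (XSet_subset _ _ _) (MS_subset _)
  have hinter : ∀ {X Y : ZFSet.{u}}, X ∈ S.U τ → (∀ x ∈ X, x ∈ MS S.κ → x ∈ Y) →
      Y ⊆ MS S.κ → Y ∈ S.U τ := fun hX h hY =>
    hF.mem_of_superset _ (hF.inter_mem _ hX _ hMS) _
      (fun x hx => h x (ZFSet.mem_inter.1 hx).1 (ZFSet.mem_inter.1 hx).2)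
      fun x hx => MS_subset _ (hY hx)
  let W : ZFSet.{u} := ZFSet.sep (fun X => X ⊆ MS S.κ) (S.U τ)
  have hmem : ∀ {X : ZFSet.{u}}, X ∈ W ↔ X ∈ S.U τ ∧ X ⊆ MS S.κ := ZFSet.mem_sep
  have hsep : ∀ p : ZFSet.{u} → Prop, ZFSet.sep p (MS S.κ) ⊆ MS S.κ :=
    fun p x hx => (ZFSet.mem_sep.1 hx).1
  refine ⟨W, ⟨⟨fun X hX => (hmem.1 hX).2, hmem.2 ⟨hMS, fun _ h => h⟩,
    fun h => hF.empty_notMem (hmem.1 h).1, fun X hX Y hXY hY => hmem.2 ⟨?_, hY⟩,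
    fun X hX Y hY => hmem.2 ⟨hF.inter_mem _ (hmem.1 hX).1 _ (hmem.1 hY).1,
      fun x hx => (hmem.1 hX).2 (ZFSet.mem_inter.1 hx).1⟩⟩,
    fun I hI A hA => hmem.2 ⟨?_, hsep _⟩,
    fun α hα => hmem.2 ⟨hS.sep_lt_first_mem hτ hMS hα, hsep _⟩,
    fun X hX => ⟨τ, hτ, (hmem.1 hX).1⟩, fun μ _ => ?_, ?_⟩,
    fun A hA => hmem.2 ⟨?_, diagInter_subset _ _⟩⟩
  · exact hinter (hmem.1 hX).1 (fun x hx _ => hXY hx) hY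
  · exact hinter ((hS.measure τ hτ).complete I hI A fun i => (hmem.1 (hA i)).1)
      (fun x hx hxMS => ZFSet.mem_sep.2 ⟨hxMS, (ZFSet.mem_sep.1 hx).2⟩) (hsep _)
  · have hdiff : MS S.κ \ XSet S.κ b μ ⊆ MS S.κ := fun x hx => (ZFSet.mem_sdiff.1 hx).1
    refine ((hS.measure τ hτ).ultra (XSet S.κ b μ)
      fun x hx => MS_subset _ (XSet_subset _ _ _ hx)).imp
      (fun h => hmem.2 ⟨h, XSet_subset _ _ _⟩) fun h => hmem.2 ⟨hinter h ?_ hdiff, hdiff⟩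
    exact fun x hx hxMS => ZFSet.mem_sdiff.2 ⟨hxMS, (ZFSet.mem_sdiff.1 hx).2⟩
  · have : bracket S.κ b W = bracket S.κ b (S.U τ) := by
      ext μ
      simp only [bracket, ZFSet.mem_sep, hmem, XSet_subset, and_true]
    rwa [this]
  · exact hinter ((hS.measure τ hτ).normal A fun y hy => (hmem.1 (hA y hy)).1)
      (fun x hx hxMS => ZFSet.mem_sep.2 ⟨hxMS, (ZFSet.mem_sep.1 hx).2⟩) (diagInter_subset _ _)

end MSeq

theorem mainTheorem9 (S : MSeq.{u}) (hS : S.IsMeasureSequence) :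
    S.WRPPlus ↔ S.LRP := by
  constructor
  · intro h b hb
    obtain ⟨W, hW, hn⟩ := h b hb
    exact hS.exists_bracket_mem_cap hW hn
  · intro h b hb
    obtain ⟨τ, hτ, hbτ⟩ := h b hb
    exact hS.exists_isRepeatFilter hτ hbτ
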